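/- Let $A\in\mathbb R^{n\times n}$, $B\in\mathbb R^{n\times p}$, $C\in\mathbb R^{m\times n}$, let $P_0\in\mathbb R^{n\times n}$ be symmetric and non-negative, and let $0<T<\infty$. For $0\le\tau\le T$, $\xi\in\mathbb R^n$ and $u\in L^2((\tau,T);\mathbb R^p)$ let $x\in C([\tau,T];\mathbb R^n)$ be the solution of $x'=Ax+Bu$ in $(\tau,T)$, $x(\tau)=\xi$, that is, $x(s)=\xi+\int_\tau^s (Ax(r)+Bu(r))\,dr$ for $s\in[\tau,T]$, and put $$J_{\tau,T}(x,u)=\int_\tau^T\big(\|Cx(s)\|^2+\|u(s)\|^2\big)\,ds+\langle P_0x(T),x(T)\rangle .$$ For every $\tau\in[0,T]$ there is exactly one symmetric matrix $P_T(\tau)\in\mathbb R^{n\times n}$ such that for all $\xi\in\mathbb R^n$ $$\langle P_T(\tau)\xi,\xi\rangle=\inf_{u\in L^2((\tau,T);\mathbb R^p)}J_{\tau,T}(x,u),\qquad\text{where } x'=Ax+Bu \text{ in } (\tau,T),\ x(\tau)=\xi .$$ Let $\xi\in\mathbb R^n$. There is exactly one control $\tilde u\in L^2((0,T);\mathbb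 R^p)$ (up to equality almost everywhere) which, with the corresponding solution $\tilde x$, minimizes $J_{0,T}$ among all $u\in L^2((0,T);\mathbb R^p)$ and the corresponding solutions $x$ starting from $x(0)=\xi$. It satisfies $$\tilde x'=A\tilde x+B\tilde u\ \text{ in }(0,T),\qquad \tilde x(0)=\xi,$$ $$\tilde u=-B^\top\tilde y\ \text{ almost everywhere in }(0,T),$$ where the adjoint state $\tilde y\in C([0,T];\mathbb R^n)$ is the solution of $$\tilde y'=-A^\top\tilde y-C^\top C\tilde x\ \text{ in }(0,T),\qquad \tilde y(T)=P_0\tilde x(T).$$ Moreover, $$\tilde y(t)=P_T(t)\tilde x(t)\quad\text{for all } t\in[0,T],$$ and consequently $$\tilde u(t)=-B^\top P_T(t)\tilde x(t)\quad\text{for almost every } t\in[0,T].$$ -/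

import Mathlib

open MeasureTheory Set

/-- `u ∈ L²((t, T); ℝᵖ)`. -/
def IsLQControl {p : ℕ} (t T : ℝ) (u : ℝ → EuclideanSpace ℝ (Fin p)) : Prop :=
  MemLp u 2 (volume.restrict (Ioo t T))

/-- `x ∈ C([t, T]; ℝⁿ)` is the solution of `x' = A x + B u` in `(t, T)`, `x(t) = ξ`, in the
(integral) sense used for an `L²` control `u`. -/
def IsLQTrajectory {n p : ℕ} (A : Matrix (Fin n) (Fin n) ℝ) (B : Matrix (Fin n) (Fin p) ℝ)
    (t T : ℝ) (ξ : EuclideanSpace ℝ (Fin n)) (x : ℝ → EuclideanSpace ℝ (Fin n))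
    (u : ℝ → EuclideanSpace ℝ (Fin p)) : Prop :=
  ContinuousOn x (Icc t T) ∧
    ∀ s ∈ Icc t T,
      x s = ξ + ∫ r in t..s, (Matrix.toEuclideanLin A (x r) + Matrix.toEuclideanLin B (u r))

/-- `(x, u)` is admissible from time `t` and state `ξ`: `u` is an `L²` control on `(t, T)` and `x`
is the corresponding solution. -/
def IsLQAdmissible {n p : ℕ} (A : Matrix (Fin n) (Fin n) ℝ) (B : Matrix (Fin n) (Fin p) ℝ)
    (t T : ℝ) (ξ : EuclideanSpace ℝ (Fin n)) (x : ℝ → EuclideanSpace ℝ (Fin n))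
    (u : ℝ → EuclideanSpace ℝ (Fin p)) : Prop :=
  IsLQControl t T u ∧ IsLQTrajectory A B t T ξ x u

/-- The cost `J_{t,T}(x, u) = ∫_t^T (‖C x‖² + ‖u‖²) ds + ⟨P₀ x(T), x(T)⟩`. -/
noncomputable def lqCost {n p m : ℕ} (C : Matrix (Fin m) (Fin n) ℝ) (P₀ : Matrix (Fin n) (Fin n) ℝ)
    (t T : ℝ) (x : ℝ → EuclideanSpace ℝ (Fin n)) (u : ℝ → EuclideanSpace ℝ (Fin p)) : ℝ :=
  (∫ s in t..T, (‖Matrix.toEuclideanLin C (x s)‖ ^ 2 + ‖u s‖ ^ 2)) +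
    inner ℝ (Matrix.toEuclideanLin P₀ (x T)) (x T)

/-- `(x, u)` is an optimal solution of the problem on `(t, T)` with initial state `ξ`. -/
def IsLQOptimal {n p m : ℕ} (A : Matrix (Fin n) (Fin n) ℝ) (B : Matrix (Fin n) (Fin p) ℝ)
    (C : Matrix (Fin m) (Fin n) ℝ) (P₀ : Matrix (Fin n) (Fin n) ℝ)
    (t T : ℝ) (ξ : EuclideanSpace ℝ (Fin n)) (x : ℝ → EuclideanSpace ℝ (Fin n))
    (u : ℝ → EuclideanSpace ℝ (Fin p)) : Prop :=
  IsLQAdmissible A B t T ξ x u ∧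
    ∀ x' u', IsLQAdmissible A B t T ξ x' u' → lqCost C P₀ t T x u ≤ lqCost C P₀ t T x' u'

/-- `P` is the matrix `P_T(τ)`: it is symmetric and, for every `ξ`, `⟨P ξ, ξ⟩` is the infimum of the
cost over `(τ, T)` with initial state `ξ` at time `τ`. For `τ = T` every admissible pair has
`x(T) = ξ`, so that the infimum is `⟨P₀ ξ, ξ⟩`. -/
def IsLQValueMatrix {n p m : ℕ} (A : Matrix (Fin n) (Fin n) ℝ) (B : Matrix (Fin n) (Fin p) ℝ)
    (C : Matrix (Fin m) (Fin n) ℝ) (P₀ : Matrix (Fin n) (Fin n) ℝ)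
    (T τ : ℝ) (P : Matrix (Fin n) (Fin n) ℝ) : Prop :=
  P.IsSymm ∧
    ∀ ξ : EuclideanSpace ℝ (Fin n),
      IsGLB {J : ℝ | ∃ x u, IsLQAdmissible A B τ T ξ x u ∧ J = lqCost C P₀ τ T x u}
        (inner ℝ (Matrix.toEuclideanLin P ξ) ξ)

/-- `y` is the adjoint state of `x`: `y' = -Aᵀ y - Cᵀ C x` in `(0, T)`, `y(T) = P₀ x(T)`.
As `x` is continuous, this is a classical equation. -/
def IsLQAdjointState {n m : ℕ} (A : Matrix (Fin n) (Fin n) ℝ)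
    (C : Matrix (Fin m) (Fin n) ℝ) (P₀ : Matrix (Fin n) (Fin n) ℝ)
    (T : ℝ) (x y : ℝ → EuclideanSpace ℝ (Fin n)) : Prop :=
  ContinuousOn y (Icc 0 T) ∧
    (∀ t ∈ Ioo 0 T, HasDerivAt y
      (-Matrix.toEuclideanLin A.transpose (y t) - Matrix.toEuclideanLin (C.transpose * C) (x t)) t) ∧
    y T = Matrix.toEuclideanLin P₀ (x T)

/-!
An extremal consists of a state `x` driven by the control `-B† y` and of its adjoint state `y`.
Integration by parts shows that the symmetric bilinear form of the cost, evaluated at an extremal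
and at any admissible pair starting from `ζ`, equals `⟪y(τ), ζ⟫`. Hence the cost of an extremal is
`⟪y(τ), x(τ)⟫`, and the cost of another admissible pair with the same initial state exceeds it by
the cost of the difference: the extremal is the unique minimizer.

Extremals are the solutions of the linear Hamiltonian system whose terminal value is
`(η, P₀ η)`, say `x(t) = X(t) η` and `y(t) = Y(t) η`. If `X(t) η = 0`, then the extremal on `[t, T]`
has zero cost, so that its control and state vanish and `η = 0`. Thus `X(t)` is invertible, every
initial state is attained, and `P(t) = Y(t) X(t)⁻¹` gives both the feedback law and the value
function. It is symmetric because the bilinear form of the cost is.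
-/

open scoped InnerProductSpace InnerProduct

/-! ### Absolute continuity and integration by parts -/

section AbsolutelyContinuous

variable {X Y E : Type*} [PseudoMetricSpace X] [PseudoMetricSpace Y] [NormedAddCommGroup E]
  {a b : ℝ}

theorem absolutelyContinuousOnInterval_of_dist_le {f : ℝ → X} {g : ℝ → Y}
    (hg : AbsolutelyContinuousOnInterval g a b)
    (hfg : ∀ s ∈ uIcc a b, ∀ t ∈ uIcc a b, dist (f s) (f t) ≤ dist (g s) (g t)) :
    AbsolutelyContinuousOnInterval f a b := by
  rw [absolutelyContinuousOnInterval_iff] at hg ⊢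
  intro ε hε
  obtain ⟨δ, hδ, hgδ⟩ := hg ε hε
  refine ⟨δ, hδ, fun I hI hIδ => lt_of_le_of_lt ?_ (hgδ I hI hIδ)⟩
  exact Finset.sum_le_sum fun i hi => hfg _ (hI.1 i hi).1 _ (hI.1 i hi).2

theorem absolutelyContinuousOnInterval_norm {f : ℝ → E}
    (hf : AbsolutelyContinuousOnInterval f a b) :
    AbsolutelyContinuousOnInterval (fun t => ‖f t‖) a b :=
  absolutelyContinuousOnInterval_of_dist_le hf fun s _ t _ =>
    lipschitzWith_one_norm.dist_le_mul (f s) (f t) |>.trans_eq (by simp)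

theorem absolutelyContinuousOnInterval_intervalIntegral [NormedSpace ℝ E] {f : ℝ → E}
    (hf : IntervalIntegrable f volume a b) :
    AbsolutelyContinuousOnInterval (fun t => ∫ s in a..t, f s) a b := by
  have hsub : ∀ t ∈ uIcc a b, IntervalIntegrable f volume a t := fun t ht =>
    hf.mono_set (uIcc_subset_uIcc_left ht)
  refine absolutelyContinuousOnInterval_of_dist_le
    (hf.norm.absolutelyContinuousOnInterval_intervalIntegral left_mem_uIcc) fun s hs t ht => ?_
  rw [dist_eq_norm, Real.dist_eq,
    intervalIntegral.integral_interval_sub_left (hsub s hs) (hsub t ht),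
    intervalIntegral.integral_interval_sub_left (hsub s hs).norm (hsub t ht).norm]
  exact intervalIntegral.norm_integral_le_abs_integral_norm

theorem absolutelyContinuousOnInterval_inner [InnerProductSpace ℝ E] {f g : ℝ → E}
    (hf : AbsolutelyContinuousOnInterval f a b) (hg : AbsolutelyContinuousOnInterval g a b) :
    AbsolutelyContinuousOnInterval (fun t => ⟪f t, g t⟫_ℝ) a b := by
  have hadd := absolutelyContinuousOnInterval_norm (hf.fun_add hg)
  have hsub := absolutelyContinuousOnInterval_norm (hf.fun_sub hg)
  have hpol (t : ℝ) : ⟪f t, g t⟫_ℝ =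
      4⁻¹ * (‖f t + g t‖ * ‖f t + g t‖ - ‖f t - g t‖ * ‖f t - g t‖) := by
    rw [norm_add_mul_self_real, norm_sub_mul_self_real]
    ring
  simpa only [hpol] using ((hadd.fun_mul hadd).fun_sub (hsub.fun_mul hsub)).const_mul 4⁻¹

end AbsolutelyContinuous

section Calculus

variable {E : Type*} [NormedAddCommGroup E]

theorem memLp_restrict_Ioo_of_continuousOn_Icc {f : ℝ → E} {a b : ℝ}
    (hf : ContinuousOn f (Icc a b)) (p : ENNReal) : MemLp f p (volume.restrict (Ioo a b)) := by
  obtain ⟨M, hM⟩ := isCompact_Icc.exists_bound_of_continuousOn hf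
  refine MemLp.of_bound ((hf.mono Ioo_subset_Icc_self).aestronglyMeasurable measurableSet_Ioo) M ?_
  filter_upwards [ae_restrict_mem measurableSet_Ioo] with t ht
  exact hM t (Ioo_subset_Icc_self ht)

theorem integrable_inner_of_memLp_two {α : Type*} [MeasurableSpace α] {μ : Measure α}
    [InnerProductSpace ℝ E] {f g : α → E} (hf : MemLp f 2 μ) (hg : MemLp g 2 μ) :
    Integrable (fun t => ⟪f t, g t⟫_ℝ) μ :=
  (hf.norm.integrable_mul hg.norm).mono' (hf.1.inner hg.1)
    (Filter.Eventually.of_forall fun _ => norm_inner_le_norm _ _)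

theorem integral_inner_add_inner_eq_sub [InnerProductSpace ℝ E] [CompleteSpace E] {a b : ℝ}
    {f f' g g' : ℝ → E} {v w : E}
    (hf' : IntervalIntegrable f' volume a b) (hf : ∀ t ∈ uIcc a b, f t = v + ∫ s in a..t, f' s)
    (hg' : IntervalIntegrable g' volume a b) (hg : ∀ t ∈ uIcc a b, g t = w + ∫ s in a..t, g' s) :
    ∫ t in a..b, (⟪f t, g' t⟫_ℝ + ⟪f' t, g t⟫_ℝ) = ⟪f b, g b⟫_ℝ - ⟪v, w⟫_ℝ := by
  have hac (c : E) {k : ℝ → E} (hk : IntervalIntegrable k volume a b) :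
      AbsolutelyContinuousOnInterval (fun t => c + ∫ s in a..t, k s) a b :=
    (LipschitzWith.const c).lipschitzOnWith.absolutelyContinuousOnInterval.fun_add
      (absolutelyContinuousOnInterval_intervalIntegral hk)
  have hftc := (absolutelyContinuousOnInterval_inner (hac v hf') (hac w hg')).integral_deriv_eq_sub
  simp only [← hf b right_mem_uIcc, ← hg b right_mem_uIcc, intervalIntegral.integral_same,
    add_zero] at hftc
  rw [← hftc]
  refine intervalIntegral.integral_congr_ae ?_
  filter_upwards [hf'.ae_hasDerivAt_integral, hg'.ae_hasDerivAt_integral] with t hft hgt ht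
  replace ht := uIoc_subset_uIcc ht
  rw [hf t ht, hg t ht]
  exact (((hft ht a left_mem_uIcc).const_add v).inner ℝ
    ((hgt ht a left_mem_uIcc).const_add w)).deriv.symm

/-- The flow of the linear equation `z' = L z`. -/
noncomputable def linearFlow [NormedSpace ℝ E] (L : E →L[ℝ] E) (t : ℝ) : E →L[ℝ] E :=
  NormedSpace.exp (t • L)

theorem linearFlow_zero [NormedSpace ℝ E] (L : E →L[ℝ] E) :
    linearFlow L 0 = ContinuousLinearMap.id ℝ E := by
  rw [linearFlow, zero_smul, NormedSpace.exp_zero]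
  rfl

theorem hasDerivAt_linearFlow [NormedSpace ℝ E] [CompleteSpace E] (L : E →L[ℝ] E) (v : E) (t : ℝ) :
    HasDerivAt (fun t => linearFlow L t v) (L (linearFlow L t v)) t :=
  ((hasDerivAt_exp_smul_const' (𝕂 := ℝ) L t).clm_apply (hasDerivAt_const t v)).congr_deriv
    (by simp [linearFlow])

theorem eqOn_zero_of_hasDerivAt_clm [NormedSpace ℝ E] [CompleteSpace E] (L : E →L[ℝ] E)
    {a b t₀ : ℝ} {z : ℝ → E} (hz : ContinuousOn z (Icc a b))
    (hz' : ∀ t ∈ Ioo a b, HasDerivAt z (L (z t)) t) (ht₀ : t₀ ∈ Icc a b) (h₀ : z t₀ = 0) :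
    EqOn z 0 (Icc a b) := by
  let φ : ℝ → E := fun t => NormedSpace.exp (t • -L) (z t)
  have hexp := hasDerivAt_exp_smul_const (𝕂 := ℝ) (-L)
  have hφ : ContinuousOn φ (Icc a b) :=
    (continuous_iff_continuousAt.2 fun t => (hexp t).continuousAt).continuousOn.clm_apply hz
  have hφ' : ∀ t ∈ Ioo a b, HasDerivAt φ 0 t := fun t ht =>
    ((hexp t).clm_apply (hz' t ht)).congr_deriv (by simp)
  have hconst : ∀ t ∈ Icc a b, φ t = φ a := fun t ht => by
    have := intervalIntegral.integral_eq_sub_of_hasDerivAt_of_le ht.1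
      (hφ.mono (Icc_subset_Icc_right ht.2)) (fun s hs => hφ' s ⟨hs.1, hs.2.trans_le ht.2⟩)
      intervalIntegrable_const
    rwa [intervalIntegral.integral_zero, eq_comm, sub_eq_zero] at this
  intro t ht
  have hφt : φ t = 0 := by
    rw [hconst t ht, ← hconst t₀ ht₀]
    simp [φ, h₀]
  obtain ⟨e, he⟩ := NormedSpace.isUnit_exp_of_mem_ball (𝕂 := ℝ) (x := t • -L)
    ((NormedSpace.expSeries_radius_eq_top ℝ (E →L[ℝ] E)).symm ▸ edist_lt_top _ _)
  calc z t = (↑e⁻¹ * ↑e : E →L[ℝ] E) (z t) := by simp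
    _ = (↑e⁻¹ : E →L[ℝ] E) (φ t) := by rw [he]; rfl
    _ = 0 := by rw [hφt, map_zero]

end Calculus

/-! ### Admissible pairs and their cost -/

/-- The data of a linear-quadratic control problem on Hilbert spaces: from time `τ` and state `ξ`,
minimize `∫_τ^T (‖C x‖² + ‖u‖²) ds + ⟪P₀ x(T), x(T)⟫` subject to `x' = A x + B u`, `x(τ) = ξ`.
The initial time is left free, so that the problem can be started along a trajectory. -/
structure LQProblem (E F G : Type*) [NormedAddCommGroup E] [InnerProductSpace ℝ E]
    [NormedAddCommGroup F] [InnerProductSpace ℝ F] [NormedAddCommGroup G]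
    [InnerProductSpace ℝ G] where
  A : E →L[ℝ] E
  B : F →L[ℝ] E
  C : E →L[ℝ] G
  P₀ : E →L[ℝ] E
  isPositive_P₀ : P₀.IsPositive
  T : ℝ

namespace LQProblem

variable {E F G : Type*} [NormedAddCommGroup E] [InnerProductSpace ℝ E]
  [NormedAddCommGroup F] [InnerProductSpace ℝ F] [NormedAddCommGroup G] [InnerProductSpace ℝ G]
  {D : LQProblem E F G} {τ : ℝ} {ξ ζ : E} {x y z x' y' : ℝ → E} {u v : ℝ → F}

/-- `u` is a square integrable control on `(τ, T)` and `x` the corresponding mild solution of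
`x' = A x + B u`, `x(τ) = ξ`. -/
structure IsAdmissible (D : LQProblem E F G) (τ : ℝ) (ξ : E) (x : ℝ → E) (u : ℝ → F) :
    Prop where
  memLp : MemLp u 2 (volume.restrict (Ioo τ D.T))
  continuousOn : ContinuousOn x (Icc τ D.T)
  eq_integral : ∀ s ∈ Icc τ D.T, x s = ξ + ∫ r in τ..s, (D.A (x r) + D.B (u r))

/-- The cost `J_{τ,T}(x, u)`. -/
noncomputable def cost (D : LQProblem E F G) (τ : ℝ) (x : ℝ → E) (u : ℝ → F) : ℝ :=
  (∫ s in τ..D.T, (‖D.C (x s)‖ ^ 2 + ‖u s‖ ^ 2)) + ⟪D.P₀ (x D.T), x D.T⟫_ℝ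

/-- The symmetric bilinear form whose quadratic form is the cost. -/
noncomputable def costForm (D : LQProblem E F G) (τ : ℝ) (x : ℝ → E) (u : ℝ → F) (z : ℝ → E)
    (v : ℝ → F) : ℝ :=
  (∫ s in τ..D.T, (⟪D.C (x s), D.C (z s)⟫_ℝ + ⟪u s, v s⟫_ℝ)) + ⟪D.P₀ (x D.T), z D.T⟫_ℝ

/-- `(x, u)` minimizes the cost among the admissible pairs starting from `ξ` at time `τ`. -/
def IsOptimal (D : LQProblem E F G) (τ : ℝ) (ξ : E) (x : ℝ → E) (u : ℝ → F) : Prop :=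
  D.IsAdmissible τ ξ x u ∧ ∀ x' u', D.IsAdmissible τ ξ x' u' → D.cost τ x u ≤ D.cost τ x' u'

/-- `P` is the operator of the value function at time `τ`, the paper's `P_T(τ)`. -/
structure IsValueOperator (D : LQProblem E F G) (τ : ℝ) (P : E →L[ℝ] E) : Prop where
  isSymmetric : (P : E →ₗ[ℝ] E).IsSymmetric
  isGLB : ∀ ξ, IsGLB {J | ∃ x u, D.IsAdmissible τ ξ x u ∧ J = D.cost τ x u} ⟪P ξ, ξ⟫_ℝ

theorem costForm_self : D.costForm τ x u x u = D.cost τ x u := by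
  simp only [costForm, cost, real_inner_self_eq_norm_sq]

theorem costForm_comm : D.costForm τ x u z v = D.costForm τ z v x u := by
  simp only [costForm, D.isPositive_P₀.inner_left_eq_inner_right (x D.T),
    real_inner_comm (D.P₀ (z D.T)), real_inner_comm (D.C (z _)), real_inner_comm (v _)]

theorem cost_nonneg (hτ : τ ≤ D.T) : 0 ≤ D.cost τ x u :=
  add_nonneg (intervalIntegral.integral_nonneg hτ fun _ _ => by positivity)
    (D.isPositive_P₀.inner_nonneg_left _)

theorem IsValueOperator.unique {P Q : E →L[ℝ] E} (hP : D.IsValueOperator τ P)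
    (hQ : D.IsValueOperator τ Q) : P = Q := by
  rw [← sub_eq_zero, ← ContinuousLinearMap.coe_inj]
  refine (hP.isSymmetric.sub hQ.isSymmetric).inner_map_self_eq_zero.1 fun ξ => ?_
  simpa [inner_sub_left, sub_eq_zero] using (hP.isGLB ξ).unique (hQ.isGLB ξ)

namespace IsAdmissible

theorem memLp_clm_comp {H : Type*} [NormedAddCommGroup H] [NormedSpace ℝ H]
    (h : D.IsAdmissible τ ξ x u) (L : E →L[ℝ] H) :
    MemLp (fun s => L (x s)) 2 (volume.restrict (Ioo τ D.T)) :=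
  memLp_restrict_Ioo_of_continuousOn_Icc (L.continuous.comp_continuousOn h.continuousOn) 2

theorem intervalIntegrable_velocity (h : D.IsAdmissible τ ξ x u) (hτ : τ ≤ D.T) :
    IntervalIntegrable (fun r => D.A (x r) + D.B (u r)) volume τ D.T :=
  (intervalIntegrable_iff_integrableOn_Ioo_of_le hτ).2
    (((h.memLp_clm_comp D.A).add (D.B.comp_memLp' h.memLp)).integrable one_le_two)

theorem intervalIntegrable_costForm (hx : D.IsAdmissible τ ξ x u) (hz : D.IsAdmissible τ ζ z v)
    (hτ : τ ≤ D.T) :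
    IntervalIntegrable (fun s => ⟪D.C (x s), D.C (z s)⟫_ℝ + ⟪u s, v s⟫_ℝ) volume τ D.T :=
  (intervalIntegrable_iff_integrableOn_Ioo_of_le hτ).2
    ((integrable_inner_of_memLp_two (hx.memLp_clm_comp D.C) (hz.memLp_clm_comp D.C)).add
      (integrable_inner_of_memLp_two hx.memLp hz.memLp))

theorem intervalIntegrable_cost (h : D.IsAdmissible τ ξ x u) (hτ : τ ≤ D.T) :
    IntervalIntegrable (fun s => ‖D.C (x s)‖ ^ 2 + ‖u s‖ ^ 2) volume τ D.T := by
  simpa only [real_inner_self_eq_norm_sq] using h.intervalIntegrable_costForm h hτ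

theorem sub (hx : D.IsAdmissible τ ξ x u) (hz : D.IsAdmissible τ ζ z v) (hτ : τ ≤ D.T) :
    D.IsAdmissible τ (ξ - ζ) (x - z) (u - v) where
  memLp := hx.memLp.sub hz.memLp
  continuousOn := hx.continuousOn.sub hz.continuousOn
  eq_integral s hs := by
    have hsub : uIcc τ s ⊆ uIcc τ D.T := uIcc_subset_uIcc_left (Icc_subset_uIcc hs)
    rw [Pi.sub_apply, hx.eq_integral s hs, hz.eq_integral s hs, add_sub_add_comm,
      ← intervalIntegral.integral_sub ((hx.intervalIntegrable_velocity hτ).mono_set hsub)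
        ((hz.intervalIntegrable_velocity hτ).mono_set hsub)]
    simp only [Pi.sub_apply, map_sub, add_sub_add_comm]

theorem cost_sub (hx : D.IsAdmissible τ ξ x u) (hz : D.IsAdmissible τ ζ z v) (hτ : τ ≤ D.T) :
    D.cost τ (x - z) (u - v) = D.cost τ x u - 2 * D.costForm τ x u z v + D.cost τ z v := by
  have hxx := hx.intervalIntegrable_cost hτ
  have hxz := hx.intervalIntegrable_costForm hz hτ
  have hzz := hz.intervalIntegrable_cost hτ
  have hint : ∫ s in τ..D.T, (‖D.C ((x - z) s)‖ ^ 2 + ‖(u - v) s‖ ^ 2) =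
      (∫ s in τ..D.T, (‖D.C (x s)‖ ^ 2 + ‖u s‖ ^ 2)) -
        2 * (∫ s in τ..D.T, (⟪D.C (x s), D.C (z s)⟫_ℝ + ⟪u s, v s⟫_ℝ)) +
        ∫ s in τ..D.T, (‖D.C (z s)‖ ^ 2 + ‖v s‖ ^ 2) := by
    rw [← intervalIntegral.integral_const_mul, ← intervalIntegral.integral_sub hxx
      (hxz.const_mul 2), ← intervalIntegral.integral_add (hxx.sub (hxz.const_mul 2)) hzz]
    refine intervalIntegral.integral_congr fun s _ => ?_
    simp only [Pi.sub_apply, map_sub, norm_sub_sq_real]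
    ring
  have hterm : ⟪D.P₀ (z D.T), x D.T⟫_ℝ = ⟪D.P₀ (x D.T), z D.T⟫_ℝ := by
    rw [D.isPositive_P₀.inner_left_eq_inner_right, real_inner_comm]
  rw [cost, hint]
  simp only [cost, costForm, Pi.sub_apply, map_sub, inner_sub_left, inner_sub_right, hterm]
  ring

theorem control_ae_eq_zero (h : D.IsAdmissible τ ξ x u) (hτ : τ ≤ D.T)
    (hcost : D.cost τ x u ≤ 0) : u =ᵐ[volume.restrict (Ioo τ D.T)] 0 := by
  have hnonneg : ∀ s, 0 ≤ ‖D.C (x s)‖ ^ 2 + ‖u s‖ ^ 2 := fun s => by positivity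
  have hint : ∫ s in τ..D.T, (‖D.C (x s)‖ ^ 2 + ‖u s‖ ^ 2) = 0 :=
    le_antisymm
      ((le_add_of_nonneg_right (D.isPositive_P₀.inner_nonneg_left _)).trans hcost)
      (intervalIntegral.integral_nonneg hτ fun s _ => hnonneg s)
  rw [intervalIntegral.integral_eq_zero_iff_of_le_of_nonneg_ae hτ
    (Filter.Eventually.of_forall hnonneg) (h.intervalIntegrable_cost hτ)] at hint
  filter_upwards [ae_restrict_of_ae_restrict_of_subset Ioo_subset_Ioc_self hint] with s hs
  have : ‖u s‖ ^ 2 = 0 := by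
    have : ‖D.C (x s)‖ ^ 2 + ‖u s‖ ^ 2 = 0 := hs
    linarith [sq_nonneg ‖D.C (x s)‖, sq_nonneg ‖u s‖]
  simpa using this

theorem eqOn_zero [CompleteSpace E] (h : D.IsAdmissible τ 0 x u)
    (hu : u =ᵐ[volume.restrict (Ioo τ D.T)] 0) : EqOn x 0 (Icc τ D.T) := by
  intro t ht
  have hτ : τ ≤ D.T := ht.1.trans ht.2
  have hmild : ∀ s ∈ Icc τ D.T, x s = ∫ r in τ..s, D.A (x r) := fun s hs => by
    rw [h.eq_integral s hs, zero_add, intervalIntegral.integral_of_le hs.1,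
      intervalIntegral.integral_of_le hs.1, integral_Ioc_eq_integral_Ioo,
      integral_Ioc_eq_integral_Ioo]
    refine integral_congr_ae ?_
    filter_upwards [ae_restrict_of_ae_restrict_of_subset (Ioo_subset_Ioo_right hs.2) hu] with r hr
    simp [hr]
  have hAx : ContinuousOn (fun r => D.A (x r)) (Icc τ D.T) :=
    D.A.continuous.comp_continuousOn h.continuousOn
  refine eqOn_zero_of_hasDerivAt_clm D.A h.continuousOn (fun s hs => ?_) (left_mem_Icc.2 hτ)
    (by simp [hmild τ (left_mem_Icc.2 hτ)]) ht
  have hnhds := Icc_mem_nhds hs.1 hs.2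
  refine HasDerivAt.congr_of_eventuallyEq
    (intervalIntegral.integral_hasDerivAt_right ?_ ?_ (hAx.continuousAt hnhds))
    (Filter.eventually_of_mem hnhds hmild)
  · exact (hAx.mono (uIcc_of_le hs.1.le ▸ Icc_subset_Icc_right hs.2.le)).intervalIntegrable
  · exact (hAx.mono Ioo_subset_Icc_self).stronglyMeasurableAtFilter isOpen_Ioo s hs

end IsAdmissible

/-! ### Adjoint states and extremals -/

variable [CompleteSpace E] [CompleteSpace G]

/-- `y` is the adjoint state of `x` on `[τ, T]`. -/
structure IsAdjointState (D : LQProblem E F G) (τ : ℝ) (x y : ℝ → E) : Prop where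
  continuousOn : ContinuousOn y (Icc τ D.T)
  hasDerivAt : ∀ t ∈ Ioo τ D.T, HasDerivAt y (-(D.A†) (y t) - (D.C†) (D.C (x t))) t
  terminal : y D.T = D.P₀ (x D.T)

namespace IsAdjointState

theorem intervalIntegrable_velocity (hy : D.IsAdjointState τ x y)
    (hx : ContinuousOn x (Icc τ D.T)) (hτ : τ ≤ D.T) :
    IntervalIntegrable (fun t => -(D.A†) (y t) - (D.C†) (D.C (x t))) volume τ D.T := by
  refine ContinuousOn.intervalIntegrable ?_
  rw [uIcc_of_le hτ]
  have := hy.continuousOn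
  fun_prop

theorem eq_integral (hy : D.IsAdjointState τ x y) (hx : ContinuousOn x (Icc τ D.T)) :
    ∀ s ∈ Icc τ D.T, y s = y τ + ∫ t in τ..s, (-(D.A†) (y t) - (D.C†) (D.C (x t))) := fun s hs => by
  rw [intervalIntegral.integral_eq_sub_of_hasDerivAt_of_le hs.1
    (hy.continuousOn.mono (Icc_subset_Icc_right hs.2))
    (fun t ht => hy.hasDerivAt t ⟨ht.1, ht.2.trans_le hs.2⟩)
    ((hy.intervalIntegrable_velocity hx (hs.1.trans hs.2)).mono_set
      (uIcc_subset_uIcc_left (Icc_subset_uIcc hs))), add_sub_cancel]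

theorem eqOn (hy : D.IsAdjointState τ x y) (hy' : D.IsAdjointState τ x y') (hτ : τ ≤ D.T) :
    EqOn y y' (Icc τ D.T) := by
  have hzero : EqOn (y - y') 0 (Icc τ D.T) :=
    eqOn_zero_of_hasDerivAt_clm (-D.A†) (hy.continuousOn.sub hy'.continuousOn)
      (fun t ht => ((hy.hasDerivAt t ht).sub (hy'.hasDerivAt t ht)).congr_deriv (by simp; abel))
      (right_mem_Icc.2 hτ) (by simp [hy.terminal, hy'.terminal])
  exact fun t ht => sub_eq_zero.1 (hzero ht)

theorem congr (hy : D.IsAdjointState τ x y) (hxx' : EqOn x x' (Icc τ D.T)) (hτ : τ ≤ D.T) :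
    D.IsAdjointState τ x' y where
  continuousOn := hy.continuousOn
  hasDerivAt t ht := hxx' (Ioo_subset_Icc_self ht) ▸ hy.hasDerivAt t ht
  terminal := hxx' (right_mem_Icc.2 hτ) ▸ hy.terminal

variable [CompleteSpace F]

theorem costForm_eq (hy : D.IsAdjointState τ x y) (hx : ContinuousOn x (Icc τ D.T))
    (hz : D.IsAdmissible τ ζ z v) (hτ : τ ≤ D.T) :
    D.costForm τ x (fun t => -(D.B†) (y t)) z v = ⟪y τ, ζ⟫_ℝ := by
  have hparts := integral_inner_add_inner_eq_sub (hy.intervalIntegrable_velocity hx hτ)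
    (uIcc_of_le hτ ▸ hy.eq_integral hx) (hz.intervalIntegrable_velocity hτ)
    (uIcc_of_le hτ ▸ hz.eq_integral)
  have hpair : ∀ s, ⟪D.C (x s), D.C (z s)⟫_ℝ + ⟪-(D.B†) (y s), v s⟫_ℝ =
      -(⟪y s, D.A (z s) + D.B (v s)⟫_ℝ + ⟪-(D.A†) (y s) - (D.C†) (D.C (x s)), z s⟫_ℝ) := fun s => by
    simp only [inner_add_right, inner_sub_left, inner_neg_left,
      ContinuousLinearMap.adjoint_inner_left]
    ring
  rw [costForm]
  simp only [hpair, intervalIntegral.integral_neg]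
  rw [hparts, hy.terminal]
  ring

end IsAdjointState

variable [CompleteSpace F]

/-- `(x, y)` is a Pontryagin extremal on `[τ, T]`: `y` is the adjoint state of `x`, and `x` is
driven by the control `-B† y`. -/
structure IsExtremal (D : LQProblem E F G) (τ : ℝ) (x y : ℝ → E) : Prop where
  isAdmissible : D.IsAdmissible τ (x τ) x (fun t => -(D.B†) (y t))
  isAdjointState : D.IsAdjointState τ x y

namespace IsExtremal

theorem costForm_eq (h : D.IsExtremal τ x y) (hz : D.IsAdmissible τ ζ z v) (hτ : τ ≤ D.T) :
    D.costForm τ x (fun t => -(D.B†) (y t)) z v = ⟪y τ, ζ⟫_ℝ :=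
  h.isAdjointState.costForm_eq h.isAdmissible.continuousOn hz hτ

theorem inner_costate_comm (h : D.IsExtremal τ x y) (h' : D.IsExtremal τ x' y') (hτ : τ ≤ D.T) :
    ⟪y τ, x' τ⟫_ℝ = ⟪y' τ, x τ⟫_ℝ := by
  rw [← h.costForm_eq h'.isAdmissible hτ, ← h'.costForm_eq h.isAdmissible hτ, costForm_comm]

theorem cost_eq (h : D.IsExtremal τ x y) (hτ : τ ≤ D.T) :
    D.cost τ x (fun t => -(D.B†) (y t)) = ⟪y τ, x τ⟫_ℝ := by
  rw [← costForm_self, h.costForm_eq h.isAdmissible hτ]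

theorem cost_eq_add_cost_sub (h : D.IsExtremal τ x y) (hz : D.IsAdmissible τ (x τ) z v)
    (hτ : τ ≤ D.T) :
    D.cost τ z v = D.cost τ x (fun t => -(D.B†) (y t)) +
      D.cost τ (z - x) (v - fun t => -(D.B†) (y t)) := by
  rw [hz.cost_sub h.isAdmissible hτ, costForm_comm, h.costForm_eq hz hτ, h.cost_eq hτ]
  ring

theorem isOptimal (h : D.IsExtremal τ x y) (hτ : τ ≤ D.T) :
    D.IsOptimal τ (x τ) x (fun t => -(D.B†) (y t)) :=
  ⟨h.isAdmissible, fun _ _ hz =>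
    (le_add_of_nonneg_right (cost_nonneg hτ)).trans_eq (h.cost_eq_add_cost_sub hz hτ).symm⟩

theorem isLeast_cost (h : D.IsExtremal τ x y) (hτ : τ ≤ D.T) :
    IsLeast {J | ∃ z v, D.IsAdmissible τ (x τ) z v ∧ J = D.cost τ z v} ⟪y τ, x τ⟫_ℝ := by
  rw [← h.cost_eq hτ]
  refine ⟨⟨x, _, h.isAdmissible, rfl⟩, ?_⟩
  rintro _ ⟨z, v, hz, rfl⟩
  exact (h.isOptimal hτ).2 z v hz

theorem eq_of_isOptimal (h : D.IsExtremal τ x y) (hz : D.IsOptimal τ (x τ) z v) (hτ : τ ≤ D.T) :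
    (∀ᵐ t ∂volume.restrict (Ioo τ D.T), v t = -(D.B†) (y t)) ∧ EqOn z x (Icc τ D.T) := by
  have hadm : D.IsAdmissible τ 0 (z - x) (v - fun t => -(D.B†) (y t)) := by
    simpa only [sub_self] using hz.1.sub h.isAdmissible hτ
  have hcontrol := hadm.control_ae_eq_zero hτ <| by
    linarith [h.cost_eq_add_cost_sub hz.1 hτ, hz.2 _ _ h.isAdmissible]
  exact ⟨hcontrol.mono fun t ht => sub_eq_zero.1 ht,
    fun t ht => sub_eq_zero.1 (hadm.eqOn_zero hcontrol ht)⟩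

theorem state_terminal_eq_zero (h : D.IsExtremal τ x y) (hx : x τ = 0) (hτ : τ ≤ D.T) :
    x D.T = 0 := by
  have hcontrol := h.isAdmissible.control_ae_eq_zero hτ <| by
    rw [h.cost_eq hτ, hx, inner_zero_right]
  exact (hx ▸ h.isAdmissible).eqOn_zero hcontrol (right_mem_Icc.2 hτ)

end IsExtremal

/-! ### The Hamiltonian flow and the Riccati operator -/

variable (D)

/-- The generator of the Hamiltonian system `x' = A x - B B† y`, `y' = -A† y - C† C x`. -/
noncomputable def hamiltonian : E × E →L[ℝ] E × E :=
  (D.A ∘L .fst ℝ E E - D.B ∘L D.B† ∘L .snd ℝ E E).prod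
    (-D.A† ∘L .snd ℝ E E - D.C† ∘L D.C ∘L .fst ℝ E E)

/-- The solution of the Hamiltonian system with terminal value `(η, P₀ η)`, as a function
of `η`. -/
noncomputable def flow (t : ℝ) : E →L[ℝ] E × E :=
  linearFlow D.hamiltonian (t - D.T) ∘L (ContinuousLinearMap.id ℝ E).prod D.P₀

/-- The state component of `LQProblem.flow`. -/
noncomputable def flowState (t : ℝ) : E →L[ℝ] E := .fst ℝ E E ∘L D.flow t

/-- The costate component of `LQProblem.flow`. -/
noncomputable def flowCostate (t : ℝ) : E →L[ℝ] E := .snd ℝ E E ∘L D.flow t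

/-- The feedback operator `Y(t) X(t)⁻¹` of the state component `X` and the costate component `Y`
of the Hamiltonian flow. As a function of `t` it solves the Riccati equation. It is meaningful for
`t ≤ T` only, where `X(t)` is invertible. -/
noncomputable def riccati (t : ℝ) : E →L[ℝ] E :=
  D.flowCostate t ∘L (D.flowState t).inverse

theorem hasDerivAt_flow (η : E) (t : ℝ) :
    HasDerivAt (fun t => D.flow t η) (D.hamiltonian (D.flow t η)) t :=
  (hasDerivAt_linearFlow D.hamiltonian (η, D.P₀ η) (t - D.T)).comp_sub_const t D.T

theorem hasDerivAt_flowState (η : E) (t : ℝ) :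
    HasDerivAt (fun t => D.flowState t η)
      (D.A (D.flowState t η) + D.B (-(D.B†) (D.flowCostate t η))) t :=
  ((ContinuousLinearMap.fst ℝ E E).hasFDerivAt.comp_hasDerivAt t (D.hasDerivAt_flow η t)
    ).congr_deriv (by simp [hamiltonian, flowState, flowCostate, sub_eq_add_neg])

theorem hasDerivAt_flowCostate (η : E) (t : ℝ) :
    HasDerivAt (fun t => D.flowCostate t η)
      (-(D.A†) (D.flowCostate t η) - (D.C†) (D.C (D.flowState t η))) t :=
  ((ContinuousLinearMap.snd ℝ E E).hasFDerivAt.comp_hasDerivAt t (D.hasDerivAt_flow η t)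
    ).congr_deriv (by simp [hamiltonian, flowState, flowCostate])

theorem flowState_terminal (η : E) : D.flowState D.T η = η := by
  simp [flowState, flow, linearFlow_zero]

theorem flowCostate_terminal (η : E) : D.flowCostate D.T η = D.P₀ η := by
  simp [flowCostate, flow, linearFlow_zero]

theorem isExtremal_flow (τ : ℝ) (η : E) :
    D.IsExtremal τ (fun t => D.flowState t η) (fun t => D.flowCostate t η) := by
  have hstate : Continuous fun t => D.flowState t η :=
    continuous_iff_continuousAt.2 fun t => (D.hasDerivAt_flowState η t).continuousAt
  have hcostate : Continuous fun t => D.flowCostate t η :=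
    continuous_iff_continuousAt.2 fun t => (D.hasDerivAt_flowCostate η t).continuousAt
  refine
    ⟨⟨memLp_restrict_Ioo_of_continuousOn_Icc (by fun_prop) 2, hstate.continuousOn, fun s _ => ?_⟩,
    ⟨hcostate.continuousOn, fun t _ => D.hasDerivAt_flowCostate η t, ?_⟩⟩
  · rw [intervalIntegral.integral_eq_sub_of_hasDerivAt
      (fun t _ => D.hasDerivAt_flowState η t)
      (Continuous.intervalIntegrable (by fun_prop) _ _), add_sub_cancel]
  · rw [D.flowState_terminal, D.flowCostate_terminal]

section FiniteDimensional

variable {D} [FiniteDimensional ℝ E]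

theorem isInvertible_flowState {t : ℝ} (ht : t ≤ D.T) : (D.flowState t).IsInvertible := by
  have hinj : Function.Injective (D.flowState t) := by
    refine (injective_iff_map_eq_zero _).2 fun η hη => ?_
    rw [← D.flowState_terminal η]
    exact (D.isExtremal_flow t η).state_terminal_eq_zero hη ht
  exact ⟨(LinearEquiv.ofInjectiveEndo _ hinj).toContinuousLinearEquiv, by ext; rfl⟩

theorem riccati_flowState {t : ℝ} (ht : t ≤ D.T) (η : E) :
    D.riccati t (D.flowState t η) = D.flowCostate t η := by
  rw [riccati, ContinuousLinearMap.comp_apply, (isInvertible_flowState ht).inverse_apply_self]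

theorem isSymmetric_riccati {t : ℝ} (ht : t ≤ D.T) :
    (D.riccati t : E →ₗ[ℝ] E).IsSymmetric := fun ξ ζ => by
  obtain ⟨η, rfl⟩ := (isInvertible_flowState ht).surjective ξ
  obtain ⟨θ, rfl⟩ := (isInvertible_flowState ht).surjective ζ
  simp only [ContinuousLinearMap.coe_coe, riccati_flowState ht]
  rw [(D.isExtremal_flow t η).inner_costate_comm (D.isExtremal_flow t θ) ht, real_inner_comm]

theorem exists_isExtremal (hτ : τ ≤ D.T) (ξ : E) :
    ∃ x y, D.IsExtremal τ x y ∧ x τ = ξ ∧ ∀ t ≤ D.T, y t = D.riccati t (x t) := by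
  obtain ⟨η, rfl⟩ := (isInvertible_flowState hτ).surjective ξ
  exact ⟨_, _, D.isExtremal_flow τ η, rfl, fun t ht => (riccati_flowState ht η).symm⟩

theorem isValueOperator_riccati (hτ : τ ≤ D.T) : D.IsValueOperator τ (D.riccati τ) where
  isSymmetric := isSymmetric_riccati hτ
  isGLB ξ := by
    obtain ⟨x, y, hxy, rfl, hfeedback⟩ := exists_isExtremal hτ ξ
    rw [← hfeedback τ hτ]
    exact (hxy.isLeast_cost hτ).isGLB

theorem IsValueOperator.eq_riccati {P : E →L[ℝ] E} (hP : D.IsValueOperator τ P) (hτ : τ ≤ D.T) :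
    P = D.riccati τ :=
  hP.unique (isValueOperator_riccati hτ)

theorem exists_isOptimal (hτ : τ ≤ D.T) (ξ : E) : ∃ x u, D.IsOptimal τ ξ x u := by
  obtain ⟨x, y, hxy, rfl, -⟩ := exists_isExtremal hτ ξ
  exact ⟨x, _, hxy.isOptimal hτ⟩

namespace IsOptimal

theorem unique {u' : ℝ → F} (h : D.IsOptimal τ ξ x u) (h' : D.IsOptimal τ ξ x' u')
    (hτ : τ ≤ D.T) :
    (∀ᵐ t ∂volume.restrict (Ioo τ D.T), u t = u' t) ∧ EqOn x x' (Icc τ D.T) := by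
  obtain ⟨z, y, hzy, rfl, -⟩ := exists_isExtremal hτ ξ
  obtain ⟨hu, hx⟩ := hzy.eq_of_isOptimal h hτ
  obtain ⟨hu', hx'⟩ := hzy.eq_of_isOptimal h' hτ
  exact ⟨by filter_upwards [hu, hu'] with t ht ht' using ht.trans ht'.symm, hx.trans hx'.symm⟩

theorem exists_isAdjointState (h : D.IsOptimal τ ξ x u) (hτ : τ ≤ D.T) :
    ∃ y, D.IsAdjointState τ x y ∧ (∀ᵐ t ∂volume.restrict (Ioo τ D.T), u t = -(D.B†) (y t)) ∧
      ∀ t ∈ Icc τ D.T, y t = D.riccati t (x t) := by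
  obtain ⟨z, y, hzy, rfl, hfeedback⟩ := exists_isExtremal hτ ξ
  obtain ⟨hu, hxz⟩ := hzy.eq_of_isOptimal h hτ
  exact ⟨y, hzy.isAdjointState.congr hxz.symm hτ, hu, fun t ht => by rw [hxz ht, hfeedback t ht.2]⟩

theorem costate_eq_riccati (h : D.IsOptimal τ ξ x u) (hy : D.IsAdjointState τ x y)
    (hτ : τ ≤ D.T) : ∀ t ∈ Icc τ D.T, y t = D.riccati t (x t) := by
  obtain ⟨y', hy', -, hfeedback⟩ := h.exists_isAdjointState hτ
  exact fun t ht => (hy.eqOn hy' hτ ht).trans (hfeedback t ht)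

theorem control_eq (h : D.IsOptimal τ ξ x u) (hy : D.IsAdjointState τ x y) (hτ : τ ≤ D.T) :
    ∀ᵐ t ∂volume.restrict (Ioo τ D.T), u t = -(D.B†) (y t) := by
  obtain ⟨y', hy', hu, -⟩ := h.exists_isAdjointState hτ
  filter_upwards [hu, ae_restrict_mem measurableSet_Ioo] with t ht hmem
  rw [ht, hy.eqOn hy' hτ (Ioo_subset_Icc_self hmem)]

end IsOptimal

end FiniteDimensional

end LQProblem

theorem theorem9p1_general {E F G : Type*} [NormedAddCommGroup E] [InnerProductSpace ℝ E]
    [FiniteDimensional ℝ E] [NormedAddCommGroup F] [InnerProductSpace ℝ F] [CompleteSpace F]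
    [NormedAddCommGroup G] [InnerProductSpace ℝ G] [CompleteSpace G] (D : LQProblem E F G)
    {τ : ℝ} (hτ : τ ≤ D.T) :
    (∀ t ≤ D.T, ∃! P, D.IsValueOperator t P) ∧
    ∀ ξ : E,
      (∃ x u, D.IsOptimal τ ξ x u) ∧
      (∀ x u x' u', D.IsOptimal τ ξ x u → D.IsOptimal τ ξ x' u' →
        (∀ᵐ t ∂volume.restrict (Ioo τ D.T), u t = u' t) ∧ EqOn x x' (Icc τ D.T)) ∧
      ∀ x u, D.IsOptimal τ ξ x u →
        (∃ y, D.IsAdjointState τ x y) ∧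
        ∀ y, D.IsAdjointState τ x y →
          (∀ᵐ t ∂volume.restrict (Ioo τ D.T), u t = -(D.B†) (y t)) ∧
          ∀ P : ℝ → E →L[ℝ] E, (∀ t ∈ Icc τ D.T, D.IsValueOperator t (P t)) →
            (∀ t ∈ Icc τ D.T, y t = P t (x t)) ∧
            (∀ᵐ t ∂volume.restrict (Icc τ D.T), u t = -(D.B†) (P t (x t))) := by
  refine ⟨fun t ht => ⟨D.riccati t, LQProblem.isValueOperator_riccati ht,
    fun P hP => hP.eq_riccati ht⟩, fun ξ => ⟨LQProblem.exists_isOptimal hτ ξ,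
    fun x u x' u' h h' => h.unique h' hτ, fun x u h => ⟨?_, fun y hy => ?_⟩⟩⟩
  · obtain ⟨y, hy, -⟩ := h.exists_isAdjointState hτ
    exact ⟨y, hy⟩
  have hu := h.control_eq hy hτ
  refine ⟨hu, fun P hP => ?_⟩
  have hfeedback : ∀ t ∈ Icc τ D.T, y t = P t (x t) := fun t ht => by
    rw [(hP t ht).eq_riccati ht.2, h.costate_eq_riccati hy hτ t ht]
  refine ⟨hfeedback, ?_⟩
  rw [← Measure.restrict_congr_set Ioo_ae_eq_Icc]
  filter_upwards [hu, ae_restrict_mem measurableSet_Ioo] with t ht hmem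
  rw [ht, hfeedback t (Ioo_subset_Icc_self hmem)]

/-! ### Matrices -/

section Matrix

variable {j k l : ℕ}

/-- A real matrix as a continuous linear map between Euclidean spaces. -/
noncomputable def matrixCLM : Matrix (Fin k) (Fin l) ℝ ≃ₗ[ℝ]
    (EuclideanSpace ℝ (Fin l) →L[ℝ] EuclideanSpace ℝ (Fin k)) :=
  Matrix.toEuclideanLin ≪≫ₗ LinearMap.toContinuousLinearMap

theorem matrixCLM_apply (M : Matrix (Fin k) (Fin l) ℝ) (v : EuclideanSpace ℝ (Fin l)) :
    matrixCLM M v = Matrix.toEuclideanLin M v :=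
  rfl

theorem adjoint_matrixCLM (M : Matrix (Fin k) (Fin l) ℝ) :
    (matrixCLM M)† = matrixCLM M.transpose := by
  rw [← Matrix.conjTranspose_eq_transpose_of_trivial]
  simp only [matrixCLM, LinearEquiv.trans_apply, Matrix.toEuclideanLin_conjTranspose_eq_adjoint,
    LinearMap.adjoint_toContinuousLinearMap]

theorem matrixCLM_mul (M : Matrix (Fin k) (Fin l) ℝ) (N : Matrix (Fin l) (Fin j) ℝ) :
    matrixCLM (M * N) = matrixCLM M ∘L matrixCLM N := by
  ext1 v
  simp [matrixCLM_apply, Matrix.toLpLin_apply, Matrix.mulVec_mulVec]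

theorem isSymm_iff_isSymmetric_matrixCLM (M : Matrix (Fin k) (Fin k) ℝ) :
    M.IsSymm ↔ (matrixCLM M : EuclideanSpace ℝ (Fin k) →ₗ[ℝ] _).IsSymmetric := by
  rw [← Matrix.isHermitian_iff_isSymm]
  exact Matrix.isSymmetric_toEuclideanLin_iff.symm

end Matrix

section Transfer

variable {n p m : ℕ} {A : Matrix (Fin n) (Fin n) ℝ} {B : Matrix (Fin n) (Fin p) ℝ}
  {C : Matrix (Fin m) (Fin n) ℝ} {P₀ : Matrix (Fin n) (Fin n) ℝ} {T τ : ℝ}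
  {ξ : EuclideanSpace ℝ (Fin n)} {x y : ℝ → EuclideanSpace ℝ (Fin n)}
  {u : ℝ → EuclideanSpace ℝ (Fin p)}

/-- The linear-quadratic control problem given by matrices. -/
noncomputable def LQProblem.ofMatrix (A : Matrix (Fin n) (Fin n) ℝ) (B : Matrix (Fin n) (Fin p) ℝ)
    (C : Matrix (Fin m) (Fin n) ℝ) {P₀ : Matrix (Fin n) (Fin n) ℝ} (hP₀ : P₀.PosSemidef) (T : ℝ) :
    LQProblem (EuclideanSpace ℝ (Fin n)) (EuclideanSpace ℝ (Fin p)) (EuclideanSpace ℝ (Fin m)) where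
  A := matrixCLM A
  B := matrixCLM B
  C := matrixCLM C
  P₀ := matrixCLM P₀
  isPositive_P₀ := LinearMap.isPositive_toContinuousLinearMap_iff _ |>.2
    (Matrix.isPositive_toEuclideanLin_iff.2 hP₀)
  T := T

open LQProblem

theorem isLQAdmissible_iff (hP₀ : P₀.PosSemidef) :
    IsLQAdmissible A B τ T ξ x u ↔ (ofMatrix A B C hP₀ T).IsAdmissible τ ξ x u :=
  ⟨fun ⟨hu, hx, hsol⟩ => ⟨hu, hx, hsol⟩, fun ⟨hu, hx, hsol⟩ => ⟨hu, hx, hsol⟩⟩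

theorem isLQOptimal_iff (hP₀ : P₀.PosSemidef) :
    IsLQOptimal A B C P₀ τ T ξ x u ↔ (ofMatrix A B C hP₀ T).IsOptimal τ ξ x u := by
  simp only [IsLQOptimal, isLQAdmissible_iff (C := C) hP₀]
  rfl

theorem isLQValueMatrix_iff (hP₀ : P₀.PosSemidef) {P : Matrix (Fin n) (Fin n) ℝ} :
    IsLQValueMatrix A B C P₀ T τ P ↔ (ofMatrix A B C hP₀ T).IsValueOperator τ (matrixCLM P) := by
  simp only [IsLQValueMatrix, isSymm_iff_isSymmetric_matrixCLM, isLQAdmissible_iff (C := C) hP₀]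
  exact ⟨fun ⟨hP, hval⟩ => ⟨hP, hval⟩, fun ⟨hP, hval⟩ => ⟨hP, hval⟩⟩

theorem isLQAdjointState_iff (hP₀ : P₀.PosSemidef) :
    IsLQAdjointState A C P₀ T x y ↔ (ofMatrix A B C hP₀ T).IsAdjointState 0 x y := by
  simp only [IsLQAdjointState, ← matrixCLM_apply, matrixCLM_mul, ← adjoint_matrixCLM]
  exact ⟨fun ⟨hy, hy', hT⟩ => ⟨hy, hy', hT⟩, fun ⟨hy, hy', hT⟩ => ⟨hy, hy', hT⟩⟩

end Transfer

theorem theorem9p1 {n p m : ℕ} (A : Matrix (Fin n) (Fin n) ℝ) (B : Matrix (Fin n) (Fin p) ℝ)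
    (C : Matrix (Fin m) (Fin n) ℝ) (P₀ : Matrix (Fin n) (Fin n) ℝ) (hP₀ : P₀.PosSemidef)
    (T : ℝ) (hT : 0 < T) :
    -- the matrices `P_T(τ)` are well defined
    (∀ τ ∈ Icc 0 T, ∃! P, IsLQValueMatrix A B C P₀ T τ P) ∧
    ∀ ξ : EuclideanSpace ℝ (Fin n),
      -- there is exactly one optimal solution
      (∃ x u, IsLQOptimal A B C P₀ 0 T ξ x u) ∧
      (∀ x u x' u', IsLQOptimal A B C P₀ 0 T ξ x u → IsLQOptimal A B C P₀ 0 T ξ x' u' →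
        (∀ᵐ t ∂(volume.restrict (Ioo 0 T)), u t = u' t) ∧ EqOn x x' (Icc 0 T)) ∧
      ∀ x u, IsLQOptimal A B C P₀ 0 T ξ x u →
        IsLQTrajectory A B 0 T ξ x u ∧
        (∃ y, IsLQAdjointState A C P₀ T x y) ∧
        ∀ y, IsLQAdjointState A C P₀ T x y →
          (∀ᵐ t ∂(volume.restrict (Ioo 0 T)),
            u t = -Matrix.toEuclideanLin B.transpose (y t)) ∧
          ∀ P : ℝ → Matrix (Fin n) (Fin n) ℝ,
            (∀ τ ∈ Icc 0 T, IsLQValueMatrix A B C P₀ T τ (P τ)) →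
              (∀ t ∈ Icc 0 T, y t = Matrix.toEuclideanLin (P t) (x t)) ∧
              (∀ᵐ t ∂(volume.restrict (Icc 0 T)),
                u t = -Matrix.toEuclideanLin B.transpose (Matrix.toEuclideanLin (P t) (x t))) := by
  obtain ⟨hval, hopt⟩ := theorem9p1_general (LQProblem.ofMatrix A B C hP₀ T) hT.le
  simp only [isLQOptimal_iff hP₀, isLQAdjointState_iff (B := B) hP₀, isLQValueMatrix_iff hP₀,
    ← matrixCLM_apply, ← adjoint_matrixCLM]
  refine ⟨fun τ hτ => matrixCLM.bijective.existsUnique_iff.1 (hval τ hτ.2), fun ξ => ?_⟩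
  obtain ⟨hex, huniq, hadj⟩ := hopt ξ
  refine ⟨hex, huniq, fun x u h => ⟨((isLQAdmissible_iff hP₀).2 h.1).2, ?_⟩⟩
  obtain ⟨hexy, hy⟩ := hadj x u h
  exact ⟨hexy, fun y hxy => ⟨(hy y hxy).1, fun P => (hy y hxy).2 fun t => matrixCLM (P t)⟩⟩
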